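/- Let $\alpha\ge 0$ and $\beta\in\mathbb R$. Write $\Delta a_n=a_{n+1}-a_n$ and $r_n=n^\alpha$, and consider, for sequences indexed by $n\ge 1$, the equation $$\Delta(n^\alpha\Delta y_n)=\frac{1}{(n+1)^{\beta}}\,y_{n+1},\qquad n\ge 1,\tag{1}$$ as a perturbation of $$\Delta(n^\alpha\Delta z_n)=0,\qquad n\ge 1.\tag{2}$$ Call $(u,v)$ a principal pair if $u=(u_n)_{n\ge1}$ and $v=(v_n)_{n\ge1}$ are real solutions of (2) such that $r_n(v_{n+1}u_n-u_{n+1}v_n)=1$ for all $n\ge 1$, $\lim_{n\to\infty}u_n/v_n=0$, and for some $n_0\ge1$ $$u_n>0,\ v_n>0\ \ (n\ge n_0),\qquad \sum_{n=n_0}^\infty\frac1{r_nu_nu_{n+1}}=\infty,\qquad \sum_{n=n_0}^\infty\frac1{r_nv_nv_{n+1}}<\infty .$$ Given a principal pair $(u,v)$, the Hartman--Wintner problem for (1) is said to be solvable if (1) has a fundamental system of (complex) solutions $\{\tilde u_n,\tilde v_n\}$ (that is, two linearly independent solutions) such that, as $n\to\infty$, $$\frac{\tilde u_n}{u_n}\to1,\qquad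 \frac{\tilde v_n}{v_n}\to 1,$$ $$\frac{\tilde u_{n+1}}{\tilde u_n}=\frac{u_{n+1}}{u_n}+o\!\left(\frac1{r_nu_nv_n}\right),\qquad \frac{\tilde v_{n+1}}{\tilde v_n}=\frac{v_{n+1}}{v_n}+o\!\left(\frac1{r_nu_nv_n}\right).$$ Then principal pairs of (2) exist, and for every principal pair the Hartman--Wintner problem for (1) is solvable if and only if $\alpha+\beta>2$. -/

import Mathlib

open Filter Topology Asymptotics

/-- `y` solves the second order difference equation
`Δ (r_n Δ y_n) = p_{n+1} y_{n+1}` for all `n ≥ N`.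
Only the values `y_n` with `n ≥ N` matter. -/
def IsDiffSolution {R : Type*} [Ring R] (N : ℕ) (r p y : ℕ → R) : Prop :=
  ∀ n, N ≤ n → fwdDiff 1 (fun k => r k * fwdDiff 1 y k) n = p (n + 1) * y (n + 1)

/-- `y, z` form a fundamental system of solutions of `Δ (r_n Δ y_n) = p_{n+1} y_{n+1}`, `n ≥ N`:
two solutions which are linearly independent as sequences indexed by `n ≥ N`. -/
structure IsFundamentalSystem {R : Type*} [Ring R] (N : ℕ) (r p y z : ℕ → R) : Prop where
  left : IsDiffSolution N r p y
  right : IsDiffSolution N r p z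
  linearIndependent : LinearIndependent R ![fun k => y (N + k), fun k => z (N + k)]

/-- `u` is a principal and `v` a non-principal solution of the real equation
`Δ (r_n Δ z_n) = q_{n+1} z_{n+1}`, `n ≥ N`, normalised by their Casoratian. -/
structure IsPrincipalPair (N : ℕ) (r q u v : ℕ → ℝ) : Prop where
  left : IsDiffSolution N r q u
  right : IsDiffSolution N r q v
  casoratian : ∀ n, N ≤ n → r n * (v (n + 1) * u n - u (n + 1) * v n) = 1
  tendsto_div : Tendsto (fun n => u n / v n) atTop (𝓝 0)
  /-- From some `n₀` on both solutions are positive, and the two series of positive terms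
  starting at `n₀` respectively diverge and converge. -/
  eventually_pos : ∃ n₀, N ≤ n₀ ∧ (∀ n, n₀ ≤ n → 0 < u n ∧ 0 < v n) ∧
    ¬ Summable (fun k => 1 / (r (n₀ + k) * u (n₀ + k) * u (n₀ + k + 1))) ∧
    Summable (fun k => 1 / (r (n₀ + k) * v (n₀ + k) * v (n₀ + k + 1)))

/-- Solvability of the Hartman–Wintner problem for the equation
`Δ (r_n Δ y_n) = (q_{n+1} + σ_{n+1}) y_{n+1}`, `n ≥ N`, seen as a perturbation of
`Δ (r_n Δ z_n) = q_{n+1} z_{n+1}`, `n ≥ N`, whose principal and non-principal solutions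
are `u` and `v`. -/
def HartmanWintnerSolvable (N : ℕ) (r q : ℕ → ℝ) (σ : ℕ → ℂ) (u v : ℕ → ℝ) : Prop :=
  ∃ u' v' : ℕ → ℂ,
    IsFundamentalSystem N (fun n => (r n : ℂ)) (fun n => (q n : ℂ) + σ n) u' v' ∧
    Tendsto (fun n => u' n / (u n : ℂ)) atTop (𝓝 1) ∧
    Tendsto (fun n => v' n / (v n : ℂ)) atTop (𝓝 1) ∧
    (fun n => u' (n + 1) / u' n - (u (n + 1) : ℂ) / (u n : ℂ))
      =o[atTop] (fun n => 1 / (r n * u n * v n)) ∧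
    (fun n => v' (n + 1) / v' n - (v (n + 1) : ℂ) / (v n : ℂ))
      =o[atTop] (fun n => 1 / (r n * u n * v n))

/-! Everything is controlled by Casoratians. If `y` solves the perturbed equation and `z` the
unperturbed one, their mixed Casoratian has increments `±σ y z`, while the pure Casoratian is
constant and gives `Δ(u/v) = -1/(r_n v_n v_{n+1})`.

For `σ ≥ 0`, convergence of `∑ σ u v` suffices for solvability: `y/v` satisfies a summed system
whose solution stays bounded (`tendsto_of_quotient_system`), and reduction of order then supplies
the partner of `u`. For `r_n = n^α`, every principal pair satisfies `u_n v_n = O(n^{1-α+ε})`, so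
with `σ_n = n^{-β}` the sum converges when `α + β > 2`.

Conversely, a solution `x ~ u` as in the problem has mixed Casoratian `X` with `u` satisfying `X_n
v_n / u_n → 0`. Over the block from `n` to `2n`, `X` grows by at least a constant times `n^{1-β}
u_n²`; since `u_n v_n` is at least a constant times `n^{1-α}` along even `n`, `n^{2-α-β}` must tend
to `0` there. -/

/-! ### Algebra of the second-order recurrence -/

theorem isDiffSolution_iff {R : Type*} [Ring R] {N : ℕ} {r p y : ℕ → R} :
    IsDiffSolution N r p y ↔ ∀ n, N ≤ n →
      r (n + 1) * (y (n + 2) - y (n + 1)) - r n * (y (n + 1) - y n) = p (n + 1) * y (n + 1) :=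
  Iff.rfl

/-- The difference of the mixed Casoratian of solutions of two equations. -/
theorem IsDiffSolution.casoratian_succ_sub {R : Type*} [CommRing R] {N : ℕ} {r p q y z : ℕ → R}
    (hy : IsDiffSolution N r p y) (hz : IsDiffSolution N r q z) {n : ℕ} (hn : N ≤ n) :
    r (n + 1) * (z (n + 2) * y (n + 1) - y (n + 2) * z (n + 1))
      - r n * (z (n + 1) * y n - y (n + 1) * z n)
      = (q (n + 1) - p (n + 1)) * (z (n + 1) * y (n + 1)) := by
  have h1 := isDiffSolution_iff.1 hy n hn
  have h2 := isDiffSolution_iff.1 hz n hn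
  linear_combination y (n + 1) * h2 - z (n + 1) * h1

theorem IsDiffSolution.const_mul {R : Type*} [CommRing R] {N : ℕ} {r p y : ℕ → R}
    (hy : IsDiffSolution N r p y) (c : R) : IsDiffSolution N r p (fun n => c * y n) := by
  refine isDiffSolution_iff.2 fun n hn => ?_
  have h1 := isDiffSolution_iff.1 hy n hn
  linear_combination c * h1

theorem IsDiffSolution.sub_const_mul {R : Type*} [CommRing R] {N : ℕ} {r p y z : ℕ → R}
    (hy : IsDiffSolution N r p y) (hz : IsDiffSolution N r p z) (c : R) :
    IsDiffSolution N r p (fun n => y n - c * z n) := by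
  refine isDiffSolution_iff.2 fun n hn => ?_
  have h1 := isDiffSolution_iff.1 hy n hn
  have h2 := isDiffSolution_iff.1 hz n hn
  linear_combination h1 - c * h2

theorem IsDiffSolution.ofReal {N : ℕ} {r p y : ℕ → ℝ} (hy : IsDiffSolution N r p y) :
    IsDiffSolution N (fun n => (r n : ℂ)) (fun n => (p n : ℂ)) (fun n => (y n : ℂ)) := by
  refine isDiffSolution_iff.2 fun n hn => ?_
  have h1 := isDiffSolution_iff.1 hy n hn
  exact_mod_cast congrArg (fun t : ℝ => (t : ℂ)) h1

theorem IsDiffSolution.re {N : ℕ} {r p : ℕ → ℝ} {y : ℕ → ℂ}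
    (hy : IsDiffSolution N (fun n => (r n : ℂ)) (fun n => (p n : ℂ)) y) :
    IsDiffSolution N r p (fun n => (y n).re) := by
  refine isDiffSolution_iff.2 fun n hn => ?_
  have h1 := congrArg Complex.re (isDiffSolution_iff.1 hy n hn)
  simpa using h1

/-- Solutions with prescribed values at two consecutive indices exist. -/
theorem exists_isDiffSolution {K : Type*} [Field K] {N : ℕ} {r : ℕ → K} (p : ℕ → K)
    (hr : ∀ n, N ≤ n → r n ≠ 0) {M : ℕ} (hM : N ≤ M) (a b : K) :
    ∃ y : ℕ → K, IsDiffSolution N r p y ∧ y M = a ∧ y (M + 1) = b := by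
  induction M, hM using Nat.le_induction generalizing a b with
  | base =>
    let g : ℕ → K × K := fun k => Nat.rec (a, b)
      (fun j s => (s.2, s.2 + (r (N + j) * (s.2 - s.1) + p (N + j + 1) * s.2) / r (N + j + 1))) k
    have hg : ∀ k, g (k + 1) = ((g k).2, (g k).2 + (r (N + k) * ((g k).2 - (g k).1)
      + p (N + k + 1) * (g k).2) / r (N + k + 1)) := fun k => rfl
    refine ⟨fun n => (g (n - N)).1, isDiffSolution_iff.2 fun n hn => ?_, by simp [g], ?_⟩
    · obtain ⟨k, rfl⟩ := Nat.exists_eq_add_of_le hn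
      have e1 : N + k + 2 - N = k + 1 + 1 := by omega
      have e2 : N + k + 1 - N = k + 1 := by omega
      have e3 : N + k - N = k := by omega
      have := hr (N + k + 1) (by omega)
      simp only [e1, e2, e3, hg]
      field_simp
      ring
    · have e2 : N + 1 - N = 0 + 1 := by omega
      simp only [e2, hg]
      rfl
  | succ M hM ih =>
    have h0 := hr M hM
    have h1 := hr (M + 1) (by omega)
    -- The value at `M` is found by running the recurrence backwards from `a` at `M + 1` and `b` at
    -- `M + 2`.
    obtain ⟨y, hy, ya, yb⟩ := ih (a - (r (M + 1) * (b - a) - p (M + 1) * a) / r M) a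
    refine ⟨y, hy, yb, ?_⟩
    have h := isDiffSolution_iff.1 hy M hM
    rw [ya, yb] at h
    have h2 : r (M + 1) * (y (M + 1 + 1) - b) = 0 := by
      have : r M * (a - (a - (r (M + 1) * (b - a) - p (M + 1) * a) / r M))
          = r (M + 1) * (b - a) - p (M + 1) * a := by field_simp; ring
      linear_combination h + this
    rcases mul_eq_zero.1 h2 with h3 | h3
    · exact absurd h3 h1
    · exact sub_eq_zero.1 h3

/-! ### Sufficiency of `∑ σ u v < ∞` for general coefficients -/

/-- Boundedness and asymptotics for the summed form of the equation satisfied by the quotient of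
a perturbed and an unperturbed solution. -/
theorem tendsto_of_quotient_system {w Q U s : ℕ → ℝ} (hw0 : w 0 = 1) (hQ0 : Q 0 = 0)
    (hU : Antitone U) (hUlim : Tendsto U atTop (𝓝 0)) (hs : ∀ n, 0 ≤ s n)
    (hw : ∀ n, w (n + 1) - w n = Q n * (U n - U (n + 1)))
    (hQ : ∀ n, Q (n + 1) - Q n = s n * w (n + 1))
    (hsum : ∀ n, ∑ k ∈ Finset.range n, s k * U (k + 1) ≤ 1 / 2) :
    ∃ L, 1 ≤ L ∧ (∀ n, 1 ≤ w n) ∧ Tendsto w atTop (𝓝 L) ∧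
      Tendsto (fun n => Q n * U n) atTop (𝓝 0) := by
  have hU0 : ∀ n, 0 ≤ U n := fun n => hU.le_of_tendsto hUlim n
  have hpos : ∀ n, 0 ≤ Q n ∧ 1 ≤ w n := by
    intro n
    induction n with
    | zero => exact ⟨hQ0.ge, hw0.ge⟩
    | succ n ih =>
      have h1 : 1 ≤ w (n + 1) := by
        have := mul_nonneg ih.1 (sub_nonneg.2 (hU n.le_succ))
        have := hw n
        linarith [ih.2]
      have := mul_nonneg (hs n) (zero_le_one.trans h1)
      exact ⟨by linarith [hQ n, ih.1], h1⟩
  have hwm : Monotone w := monotone_nat_of_le_succ fun n => by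
    have := mul_nonneg (hpos n).1 (sub_nonneg.2 (hU n.le_succ))
    linarith [hw n]
  have hQm : Monotone Q := monotone_nat_of_le_succ fun n => by
    have := mul_nonneg (hs n) (zero_le_one.trans (hpos (n + 1)).2)
    linarith [hQ n]
  -- Summation by parts: `w + Q U` increases by `s n * U (n + 1) * w (n + 1)`. As the sums of `s U`
  -- stay below `1/2`, the `w` on the right can be absorbed, giving `w ≤ 2`.
  have hz : ∀ n, w n + Q n * U n ≤ 1 + (∑ k ∈ Finset.range n, s k * U (k + 1)) * w n := by
    intro n
    induction n with
    | zero => simp [hw0, hQ0]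
    | succ n ih =>
      rw [Finset.sum_range_succ]
      have h1 : (∑ k ∈ Finset.range n, s k * U (k + 1)) * w n
          ≤ (∑ k ∈ Finset.range n, s k * U (k + 1)) * w (n + 1) :=
        mul_le_mul_of_nonneg_left (hwm n.le_succ)
          (Finset.sum_nonneg fun k _ => mul_nonneg (hs k) (hU0 _))
      have h2 : w (n + 1) + Q (n + 1) * U (n + 1)
          = w n + Q n * U n + s n * U (n + 1) * w (n + 1) := by
        linear_combination hw n + U (n + 1) * hQ n
      rw [h2]
      linarith
  have hbd : ∀ n, w n ≤ 2 := fun n => by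
    have h1 := mul_le_mul_of_nonneg_right (hsum n) (zero_le_one.trans (hpos n).2)
    have h2 := mul_nonneg (hpos n).1 (hU0 n)
    linarith [hz n]
  obtain ⟨L, hL⟩ : ∃ L, Tendsto w atTop (𝓝 L) :=
    ⟨_, tendsto_atTop_ciSup hwm ⟨2, by rintro _ ⟨n, rfl⟩; exact hbd n⟩⟩
  refine ⟨L, ge_of_tendsto' hL fun n => (hpos n).2, fun n => (hpos n).2, hL, ?_⟩
  -- Since `Q` is monotone, `w (m + k) - w m ≥ Q m * (U m - U (m + k))`; let `k → ∞`.
  have hle : ∀ m, Q m * U m ≤ L - w m := by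
    intro m
    have hmono : Monotone fun k => w (m + k) + Q m * U (m + k) :=
      monotone_nat_of_le_succ fun k => by
        have h1 := mul_le_mul_of_nonneg_right (hQm (Nat.le_add_right m k))
          (sub_nonneg.2 (hU (m + k).le_succ))
        have h2 := hw (m + k)
        simp only [← add_assoc, Nat.succ_eq_add_one] at *
        linarith
    have hlim : Tendsto (fun k => w (m + k) + Q m * U (m + k)) atTop (𝓝 (L + Q m * 0)) := by
      simp only [add_comm m]
      exact ((tendsto_add_atTop_iff_nat m).2 hL).add
        (((tendsto_add_atTop_iff_nat m).2 hUlim).const_mul _)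
    have := hmono.ge_of_tendsto hlim 0
    simp only [add_zero] at this
    linarith
  refine squeeze_zero (fun n => mul_nonneg (hpos n).1 (hU0 n)) hle ?_
  simpa using (tendsto_const_nhds (x := L)).sub hL

/-- A Stolz–Cesàro theorem for null sequences. -/
theorem tendsto_div_one_of_sub_div_sub {f g : ℕ → ℝ} {N : ℕ}
    (hg : ∀ n, N ≤ n → g (n + 1) < g n) (hf0 : Tendsto f atTop (𝓝 0))
    (hg0 : Tendsto g atTop (𝓝 0))
    (h : Tendsto (fun n => (f n - f (n + 1)) / (g n - g (n + 1))) atTop (𝓝 1)) :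
    Tendsto (fun n => f n / g n) atTop (𝓝 1) := by
  -- Applied to `g` and to both `f - (1 - ε/2) g` and `(1 + ε/2) g - f`, which decrease to `0` and
  -- are therefore nonnegative.
  have key : ∀ F : ℕ → ℝ, Tendsto F atTop (𝓝 0) → ∀ m, (∀ n, m ≤ n → F (n + 1) ≤ F n) →
      0 ≤ F m := by
    intro F hF m hm
    have ha : Antitone fun k => F (k + m) := antitone_nat_of_succ_le fun k => by
      have := hm (k + m) (by omega)
      rwa [show k + 1 + m = k + m + 1 by omega]
    simpa using ha.le_of_tendsto ((tendsto_add_atTop_iff_nat m).2 hF) 0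
  have hgpos : ∀ n, N ≤ n → 0 < g n := fun n hn =>
    (key g hg0 (n + 1) fun k hk => (hg k (by omega)).le).trans_lt (hg n hn)
  rw [Metric.tendsto_atTop] at h ⊢
  intro ε hε
  obtain ⟨K, hK⟩ := h (ε / 2) (by positivity)
  refine ⟨max K N, fun n hn => ?_⟩
  have hb : ∀ k, n ≤ k → |(f k - f (k + 1)) - (g k - g (k + 1))| ≤ ε / 2 * (g k - g (k + 1)) := by
    intro k hk
    have hd : 0 < g k - g (k + 1) :=
      sub_pos.2 (hg k ((le_max_right K N).trans (hn.trans hk)))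
    have h1 := (hK k ((le_max_left K N).trans (hn.trans hk))).le
    rw [Real.dist_eq, div_sub_one hd.ne', abs_div, abs_of_pos hd, div_le_iff₀ hd] at h1
    exact h1
  have hgn := hgpos n ((le_max_right K N).trans hn)
  have h1 := key (fun k => f k - (1 - ε / 2) * g k)
    (by simpa using hf0.sub (hg0.const_mul (1 - ε / 2))) n fun k hk => by
      have := (abs_le.1 (hb k hk)).1
      linarith
  have h2 := key (fun k => (1 + ε / 2) * g k - f k)
    (by simpa using (hg0.const_mul (1 + ε / 2)).sub hf0) n fun k hk => by
      have := (abs_le.1 (hb k hk)).2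
      linarith
  rw [Real.dist_eq, div_sub_one hgn.ne', abs_div, abs_of_pos hgn, div_lt_iff₀ hgn, abs_lt]
  have := mul_pos hε hgn
  constructor <;> linarith

theorem div_sub_div_of_casoratian {r a b a' b' : ℝ} (hr : r ≠ 0) (hb : b ≠ 0) (hb' : b' ≠ 0)
    (h : r * (b' * a - a' * b) = 1) : a / b - a' / b' = 1 / (r * b * b') := by
  field_simp
  linear_combination h

theorem tendsto_shift {f : ℕ → ℝ} {l : ℝ} (M : ℕ) (h : Tendsto f atTop (𝓝 l)) :
    Tendsto (fun n => f (n + M)) atTop (𝓝 l) :=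
  (tendsto_add_atTop_iff_nat M).2 h

/-- A solution of the perturbed equation which is asymptotic to the non-principal solution. -/
theorem exists_solution_asymptotic_nonprincipal {N : ℕ} {r q σ u v : ℕ → ℝ}
    (hr : ∀ n, N ≤ n → 0 < r n) (hσ : ∀ n, N ≤ n → 0 ≤ σ n) (h : IsPrincipalPair N r q u v)
    (hs : Summable fun n => σ n * u n * v n) :
    ∃ y : ℕ → ℝ, IsDiffSolution N r (fun n => q n + σ n) y ∧
      Tendsto (fun n => y n / v n) atTop (𝓝 1) ∧
      Tendsto (fun n => r n * u n * v n * (y (n + 1) / y n - v (n + 1) / v n)) atTop (𝓝 0) := by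
  obtain ⟨n₀, hn₀, hpos, -, -⟩ := h.eventually_pos
  obtain ⟨K, hK⟩ := eventually_atTop.1 <|
    (tendsto_sum_nat_add fun n => σ n * u n * v n).eventually_le_const
      (show (0 : ℝ) < 1 / 2 by norm_num)
  set M := max n₀ K with hMdef
  have hM₀ : n₀ ≤ M := le_max_left _ _
  have hMN : N ≤ M := hn₀.trans hM₀
  have hup : ∀ n, 0 < u (n + M) := fun n => (hpos _ (by omega)).1
  have hvp : ∀ n, 0 < v (n + M) := fun n => (hpos _ (by omega)).2
  have hrp : ∀ n, 0 < r (n + M) := fun n => hr _ (by omega)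
  have hσp : ∀ n, 0 ≤ σ (n + M) := fun n => hσ _ (by omega)
  -- Starting with the data of `v` at `M` makes the quotient `1` and the mixed Casoratian `0` there;
  -- `M` is so large that the tail of `∑ σ u v` is at most `1/2`.
  obtain ⟨y, hy, yM, yM'⟩ := exists_isDiffSolution (r := r) (fun n => q n + σ n)
    (fun n hn => (hr n hn).ne') hMN (v M) (v (M + 1))
  have hsucc : ∀ n, n + 1 + M = n + M + 1 := fun n => by omega
  have hUd : ∀ n, u (n + M) / v (n + M) - u (n + 1 + M) / v (n + 1 + M)
      = 1 / (r (n + M) * v (n + M) * v (n + 1 + M)) := fun n =>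
    div_sub_div_of_casoratian (hrp n).ne' (hvp n).ne' (hvp (n + 1)).ne' (by
      rw [hsucc]; exact h.casoratian _ (by omega))
  obtain ⟨L, hL1, hw1, hwL, hQU⟩ := tendsto_of_quotient_system
    (w := fun n => y (n + M) / v (n + M))
    (Q := fun n => r (n + M) * (y (n + M + 1) * v (n + M) - v (n + M + 1) * y (n + M)))
    (U := fun n => u (n + M) / v (n + M))
    (s := fun n => σ (n + 1 + M) * v (n + 1 + M) ^ 2)
    (by simp [yM, (hpos M hM₀).2.ne'])
    (by simp [yM, yM', mul_comm])
    (antitone_nat_of_succ_le fun n => sub_nonneg.1 (by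
      rw [hUd]
      exact (one_div_pos.2 (mul_pos (mul_pos (hrp n) (hvp n)) (hvp _))).le))
    (tendsto_shift M h.tendsto_div)
    (fun n => mul_nonneg (hσp _) (sq_nonneg _))
    (fun n => by
      have h1 := (hrp n).ne'
      have h2 := (hvp n).ne'
      have h3 := (hvp (n + 1)).ne'
      simp only [hUd]
      rw [← hsucc n]
      field_simp)
    (fun n => by
      have h3 := (hvp (n + 1)).ne'
      have h4 := h.right.casoratian_succ_sub hy (n := n + M) (by omega)
      simp only [hsucc] at *
      rw [show n + M + 1 + 1 = n + M + 2 from rfl, h4]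
      field_simp
      ring)
    (fun n => by
      have hsh : Summable fun k => σ (k + (M + 1)) * u (k + (M + 1)) * v (k + (M + 1)) :=
        (summable_nat_add_iff (f := fun n => σ n * u n * v n) (M + 1)).2 hs
      have h1 := hsh.sum_le_tsum (Finset.range n) fun k _ =>
        mul_nonneg (mul_nonneg (hσ _ (by omega)) (hpos _ (by omega)).1.le) (hpos _ (by omega)).2.le
      refine le_trans (le_of_eq (Finset.sum_congr rfl fun k _ => ?_))
        (h1.trans (hK (M + 1) ((le_max_right n₀ K).trans M.le_succ)))
      have h3 := (hvp (k + 1)).ne'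
      rw [show k + (M + 1) = k + 1 + M by omega]
      field_simp)
  have hL0 : 0 < L := zero_lt_one.trans_le hL1
  refine ⟨fun n => L⁻¹ * y n, hy.const_mul _, ?_, ?_⟩
  · refine (tendsto_add_atTop_iff_nat M).1 ?_
    have := hwL.const_mul L⁻¹
    rw [inv_mul_cancel₀ hL0.ne'] at this
    exact this.congr fun n => (mul_div_assoc _ _ _).symm
  · refine (tendsto_add_atTop_iff_nat M).1 ?_
    -- `Q U / w` equals `r u v (y_{n+1}/y_n - v_{n+1}/v_n)`.
    have := hQU.div hwL hL0.ne'
    rw [zero_div] at this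
    refine this.congr fun n => ?_
    have h1 := (hrp n).ne'
    have h2 := (hvp n).ne'
    have h3 : y (n + M) ≠ 0 := fun h0 => by
      have := hw1 n
      simp only [h0, zero_div] at this
      linarith
    have h4 := hL0.ne'
    simp only [Pi.div_apply]
    field_simp

/-- A solution of the perturbed equation which is asymptotic to the principal solution, obtained
by reduction of order. -/
theorem exists_solution_asymptotic_principal {N : ℕ} {r q p u v y : ℕ → ℝ}
    (hr : ∀ n, N ≤ n → 0 < r n) (h : IsPrincipalPair N r q u v) (hy : IsDiffSolution N r p y)
    (hyv : Tendsto (fun n => y n / v n) atTop (𝓝 1))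
    (hyr : Tendsto (fun n => r n * u n * v n * (y (n + 1) / y n - v (n + 1) / v n)) atTop (𝓝 0)) :
    ∃ x : ℕ → ℝ, IsDiffSolution N r p x ∧
      (∃ M, N ≤ M ∧ r M * (y (M + 1) * x M - x (M + 1) * y M) = 1) ∧
      Tendsto (fun n => x n / u n) atTop (𝓝 1) ∧
      Tendsto (fun n => r n * u n * v n * (x (n + 1) / x n - u (n + 1) / u n)) atTop (𝓝 0) := by
  obtain ⟨n₀, hn₀, hpos, -, -⟩ := h.eventually_pos
  obtain ⟨K, hK⟩ := eventually_atTop.1 (hyv.eventually_const_lt zero_lt_one)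
  set M := max n₀ K with hMdef
  have hM₀ : n₀ ≤ M := le_max_left _ _
  have hMN : N ≤ M := hn₀.trans hM₀
  have hu : ∀ n, M ≤ n → 0 < u n := fun n hn => (hpos n (hM₀.trans hn)).1
  have hv : ∀ n, M ≤ n → 0 < v n := fun n hn => (hpos n (hM₀.trans hn)).2
  have hyp : ∀ n, M ≤ n → 0 < y n := fun n hn =>
    (div_pos_iff_of_pos_right (hv n hn)).1 (hK n ((le_max_right _ _).trans hn))
  have hrp : ∀ n, M ≤ n → 0 < r n := fun n hn => hr n (hMN.trans hn)
  obtain ⟨z, hz, zM, zM'⟩ := exists_isDiffSolution (r := r) p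
    (fun n hn => (hr n hn).ne') hMN 0 (-(1 / (r M * y M)))
  have hzc : ∀ n, M ≤ n → r n * (y (n + 1) * z n - z (n + 1) * y n) = 1 := by
    intro n hn
    induction n, hn using Nat.le_induction with
    | base =>
      have h1 := (hrp M le_rfl).ne'
      have h2 := (hyp M le_rfl).ne'
      rw [zM, zM']
      field_simp
      ring
    | succ n hn ih =>
      have := hz.casoratian_succ_sub hy (hMN.trans hn)
      rw [show n + 1 + 1 = n + 2 from rfl]
      linear_combination this + ih
  have hfd : ∀ n, M ≤ n → z n / y n - z (n + 1) / y (n + 1) = 1 / (r n * y n * y (n + 1)) :=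
    fun n hn => div_sub_div_of_casoratian (hrp n hn).ne' (hyp n hn).ne'
      (hyp (n + 1) (by omega)).ne' (hzc n hn)
  have hgd : ∀ n, M ≤ n → u n / v n - u (n + 1) / v (n + 1) = 1 / (r n * v n * v (n + 1)) :=
    fun n hn => div_sub_div_of_casoratian (hrp n hn).ne' (hv n hn).ne'
      (hv (n + 1) (by omega)).ne' (h.casoratian n (hMN.trans hn))
  have hgpos : ∀ n, M ≤ n → 0 < u n / v n - u (n + 1) / v (n + 1) := fun n hn => by
    rw [hgd n hn]
    exact one_div_pos.2 (mul_pos (mul_pos (hrp n hn) (hv n hn)) (hv _ (by omega)))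
  have hratio : Tendsto (fun n => (z n / y n - z (n + 1) / y (n + 1)) /
      (u n / v n - u (n + 1) / v (n + 1))) atTop (𝓝 1) := by
    have h1 := (hyv.mul (tendsto_shift 1 hyv)).inv₀ (by norm_num)
    rw [mul_one, inv_one] at h1
    refine h1.congr' ?_
    filter_upwards [eventually_ge_atTop M] with n hn
    rw [hfd n hn, hgd n hn]
    have := (hrp n hn).ne'
    have := (hv n hn).ne'
    have := (hyp n hn).ne'
    have := (hv (n + 1) (by omega)).ne'
    have := (hyp (n + 1) (by omega)).ne'
    field_simp
  -- `z/y` decreases, and its drops are eventually at most twice those of `u/v`, so `z/y - 2 u/v`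
  -- increases and bounds it below. Subtracting `ℓ y` from `z` then leaves a solution with null
  -- quotient by `y`.
  obtain ⟨ℓ, hℓ⟩ : ∃ ℓ, Tendsto (fun n => z n / y n) atTop (𝓝 ℓ) := by
    obtain ⟨K', hK'⟩ := eventually_atTop.1 (hratio.eventually_le_const one_lt_two)
    set P := max M K' with hP
    have hPM : M ≤ P := le_max_left _ _
    have hPK : K' ≤ P := le_max_right _ _
    have hanti : Antitone fun n => z (n + P) / y (n + P) := antitone_nat_of_succ_le fun n => by
      have := hfd (n + P) (by omega)
      have : 0 < 1 / (r (n + P) * y (n + P) * y (n + P + 1)) := one_div_pos.2 <|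
        mul_pos (mul_pos (hrp _ (by omega)) (hyp _ (by omega))) (hyp _ (by omega))
      rw [show n + 1 + P = n + P + 1 by omega]
      linarith
    have hmono : Monotone fun n => z (n + P) / y (n + P) - 2 * (u (n + P) / v (n + P)) :=
      monotone_nat_of_le_succ fun n => by
        have h1 := hK' (n + P) (by omega)
        rw [div_le_iff₀ (hgpos _ (by omega))] at h1
        rw [show n + 1 + P = n + P + 1 by omega]
        linarith
    refine ⟨_, (tendsto_add_atTop_iff_nat P).1 (tendsto_atTop_ciInf hanti
      ⟨z (0 + P) / y (0 + P) - 2 * (u (0 + P) / v (0 + P)), ?_⟩)⟩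
    rintro _ ⟨n, rfl⟩
    have h1 := hmono n.zero_le
    have h2 := div_pos (hu (n + P) (by omega)) (hv (n + P) (by omega))
    simp only at h1 ⊢
    linarith
  have hxy : ∀ n, M ≤ n → (z n - ℓ * y n) / y n = z n / y n - ℓ := fun n hn => by
    have := (hyp n hn).ne'
    field_simp
  have hcas : ∀ n, M ≤ n →
      r n * (y (n + 1) * (z n - ℓ * y n) - (z (n + 1) - ℓ * y (n + 1)) * y n) = 1 :=
    fun n hn => by linear_combination hzc n hn
  have hst : Tendsto (fun n => (z n / y n - ℓ) / (u n / v n)) atTop (𝓝 1) := by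
    refine tendsto_div_one_of_sub_div_sub (N := M) (fun n hn => sub_pos.1 (hgpos n hn))
      (by simpa using hℓ.sub_const ℓ) h.tendsto_div (hratio.congr fun n => ?_)
    rw [sub_sub_sub_cancel_right]
  have hxu : Tendsto (fun n => (z n - ℓ * y n) / u n) atTop (𝓝 1) := by
    have h1 := hst.mul hyv
    rw [mul_one] at h1
    refine h1.congr' ?_
    filter_upwards [eventually_ge_atTop M] with n hn
    rw [← hxy n hn]
    have := (hyp n hn).ne'
    have := (hv n hn).ne'
    have := (hu n hn).ne'
    field_simp
  refine ⟨fun n => z n - ℓ * y n, hz.sub_const_mul hy ℓ, ⟨M, hMN, hcas M le_rfl⟩, hxu, ?_⟩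
  -- With `x = z - ℓ y`, the two Casoratians give `y_{n+1}/y_n - x_{n+1}/x_n = 1/(r x y)` and
  -- `v_{n+1}/v_n - u_{n+1}/u_n = 1/(r u v)`. Subtracting and multiplying by `r u v` leaves the
  -- error `uv/(xy) - 1 → 0`.
  have h1 := hyr.sub (((hxu.mul hyv).inv₀ (by norm_num)).sub_const 1)
  simp only [mul_one, inv_one, sub_self] at h1
  refine h1.congr' ?_
  filter_upwards [eventually_ge_atTop M, hxu.eventually_const_lt zero_lt_one] with n hn hx
  have hx' : z n - ℓ * y n ≠ 0 := ((div_pos_iff_of_pos_right (hu n hn)).1 hx).ne'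
  have e1 := hcas n hn
  have e2 := h.casoratian n (hMN.trans hn)
  have := (hrp n hn).ne'
  have := (hyp n hn).ne'
  have := (hv n hn).ne'
  have := (hu n hn).ne'
  generalize z n - ℓ * y n = x at *
  generalize z (n + 1) - ℓ * y (n + 1) = x' at *
  field_simp
  linear_combination (u n * v n) * e1 - y n * x * e2

theorem isLittleO_ofReal_one_div {R d : ℕ → ℝ} (hR : ∀ᶠ n in atTop, R n ≠ 0)
    (h : Tendsto (fun n => R n * d n) atTop (𝓝 0)) :
    (fun n => (d n : ℂ)) =o[atTop] fun n => 1 / R n := by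
  refine Complex.isLittleO_ofReal_left.2 ((isLittleO_iff_tendsto' ?_).2 ?_)
  · filter_upwards [hR] with n hn h0
    exact absurd h0 (one_div_ne_zero hn)
  · exact h.congr fun n => by rw [div_div_eq_mul_div, div_one, mul_comm]

theorem hartmanWintnerSolvable_of_summable {N : ℕ} {r q σ u v : ℕ → ℝ}
    (hr : ∀ n, N ≤ n → 0 < r n) (hσ : ∀ n, N ≤ n → 0 ≤ σ n) (h : IsPrincipalPair N r q u v)
    (hs : Summable fun n => σ n * u n * v n) :
    HartmanWintnerSolvable N r q (fun n => (σ n : ℂ)) u v := by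
  obtain ⟨y, hy, hyv, hyr⟩ := exists_solution_asymptotic_nonprincipal hr hσ h hs
  obtain ⟨x, hx, ⟨M, hM, hc⟩, hxu, hxr⟩ := exists_solution_asymptotic_principal hr h hy hyv hyr
  have hR : ∀ᶠ n in atTop, r n * u n * v n ≠ 0 := by
    obtain ⟨n₀, hn₀, hpos, -, -⟩ := h.eventually_pos
    filter_upwards [eventually_ge_atTop n₀] with n hn
    exact (mul_pos (mul_pos (hr n (hn₀.trans hn)) (hpos n hn).1) (hpos n hn).2).ne'
  refine ⟨fun n => x n, fun n => y n, ⟨?_, ?_, ?_⟩, ?_, ?_, ?_, ?_⟩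
  · simpa using hx.ofReal
  · simpa using hy.ofReal
  · rw [LinearIndependent.pair_iff]
    intro s t hst
    have h0 : s * x M + t * y M = 0 := by
      simpa [Nat.add_sub_cancel' hM] using congrFun hst (M - N)
    have h1 : s * x (M + 1) + t * y (M + 1) = 0 := by
      simpa [show N + (M + 1 - N) = M + 1 by omega] using congrFun hst (M + 1 - N)
    have hc' : (r M : ℂ) * (y (M + 1) * x M - x (M + 1) * y M) = 1 := by
      exact_mod_cast congrArg (fun t : ℝ => (t : ℂ)) hc
    constructor
    · linear_combination (-s) * hc' + r M * y (M + 1) * h0 - r M * y M * h1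
    · linear_combination (-t) * hc' - r M * x (M + 1) * h0 + r M * x M * h1
  · simpa [Function.comp_def] using (Complex.continuous_ofReal.tendsto 1).comp hxu
  · simpa [Function.comp_def] using (Complex.continuous_ofReal.tendsto 1).comp hyv
  · simpa using isLittleO_ofReal_one_div hR hxr
  · simpa using isLittleO_ofReal_one_div hR hyr

/-! ### Real consequences of solvability -/

/-- The real content of the asymptotics of a solution close to the principal solution. -/
theorem HartmanWintnerSolvable.exists_real {N : ℕ} {r q σ u v : ℕ → ℝ}
    (hr : ∀ n, N ≤ n → 0 < r n) (h : IsPrincipalPair N r q u v)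
    (hs : HartmanWintnerSolvable N r q (fun n => (σ n : ℂ)) u v) :
    ∃ x : ℕ → ℝ, IsDiffSolution N r (fun n => q n + σ n) x ∧
      Tendsto (fun n => x n / u n) atTop (𝓝 1) ∧
      Tendsto (fun n => r n * (x (n + 1) * u n - u (n + 1) * x n) * (v n / u n)) atTop (𝓝 0) := by
  obtain ⟨y, _, hf, hyu, -, ho, -⟩ := hs
  refine ⟨fun n => (y n).re, ?_, ?_, ?_⟩
  · exact IsDiffSolution.re (by simpa using hf.left)
  · simpa [Function.comp_def, Complex.div_ofReal_re] using
      (Complex.continuous_re.tendsto 1).comp hyu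
  · obtain ⟨n₀, hn₀, hpos, -, -⟩ := h.eventually_pos
    have h1 := (ho.norm_left.tendsto_div_nhds_zero).mul hyu.norm
    rw [zero_mul] at h1
    refine squeeze_zero_norm' ?_ h1
    filter_upwards [eventually_ge_atTop n₀, hyu.eventually_ne one_ne_zero] with n hn hy
    have hu := (hpos n hn).1
    have hv := (hpos n hn).2
    have hrn := hr n (hn₀.trans hn)
    have hy0 : y n ≠ 0 := fun h0 => hy (by simp [h0])
    have hu0 : (u n : ℂ) ≠ 0 := by exact_mod_cast hu.ne'
    -- The little-o hypothesis makes the product of the first two factors tend to `0`; the last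
    -- factor tends to `1`.
    have e1 : r n * ((y (n + 1)).re * u n - u (n + 1) * (y n).re) * (v n / u n)
        = (((r n * u n * v n : ℝ) : ℂ) * (y (n + 1) / y n - u (n + 1) / u n)
            * (y n / u n)).re := by
      have e2 : ((r n * u n * v n : ℝ) : ℂ) * (y (n + 1) / y n - u (n + 1) / u n) * (y n / u n)
          = ((r n * (v n / u n) : ℝ) : ℂ) * (y (n + 1) * u n - u (n + 1) * y n) := by
        push_cast
        field_simp
      rw [e2, Complex.re_ofReal_mul]
      simp
      ring
    rw [e1, div_div_eq_mul_div, div_one, Real.norm_eq_abs]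
    refine (Complex.abs_re_le_norm _).trans (le_of_eq ?_)
    rw [norm_mul, norm_mul, Complex.norm_real, Real.norm_of_nonneg
      (mul_pos (mul_pos hrn hu) hv).le]
    ring

/-! ### Principal pairs of the unperturbed equation -/

/-- Positive solutions with normalised Casoratian and `u / v → 0` form a principal pair. -/
theorem isPrincipalPair_of_pos {N : ℕ} {r q u v : ℕ → ℝ} (hr : ∀ n, N ≤ n → 0 < r n)
    (hu : IsDiffSolution N r q u) (hv : IsDiffSolution N r q v)
    (hc : ∀ n, N ≤ n → r n * (v (n + 1) * u n - u (n + 1) * v n) = 1)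
    (hlim : Tendsto (fun n => u n / v n) atTop (𝓝 0))
    (hpos : ∀ n, N ≤ n → 0 < u n ∧ 0 < v n) : IsPrincipalPair N r q u v := by
  have hup : ∀ k, 0 < u (N + k) := fun k => (hpos _ (by omega)).1
  have hvp : ∀ k, 0 < v (N + k) := fun k => (hpos _ (by omega)).2
  have hrp : ∀ k, 0 < r (N + k) := fun k => hr _ (by omega)
  have hlim' : Tendsto (fun k => u (N + k) / v (N + k)) atTop (𝓝 0) := by
    simpa only [add_comm N] using tendsto_shift N hlim
  refine ⟨hu, hv, hc, hlim, N, le_rfl, hpos, ?_, ?_⟩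
  · rw [not_summable_iff_tendsto_nat_atTop_of_nonneg fun k =>
      (one_div_pos.2 (mul_pos (mul_pos (hrp k) (hup k)) (show 0 < u (N + k + 1) from hup (k + 1)))).le]
    -- Both series telescope: the first in `v/u`, which tends to infinity, the second in `u/v`.
    have e : ∀ n, ∑ k ∈ Finset.range n, 1 / (r (N + k) * u (N + k) * u (N + k + 1))
        = (u (N + n) / v (N + n))⁻¹ + -(v N / u N) := fun n => by
      rw [← sub_eq_add_neg, inv_div]
      refine (Finset.sum_congr rfl fun k _ => ?_).trans
        (Finset.sum_range_sub (fun k => v (N + k) / u (N + k)) n)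
      have h1 := (hup k).ne'
      have h2 := (hup (k + 1)).ne'
      have h3 := (hrp k).ne'
      have h4 := hc (N + k) (by omega)
      simp only [← add_assoc] at *
      field_simp
      linear_combination -h4
    simp only [e]
    exact tendsto_atTop_add_const_right _ _ ((tendsto_inv_nhdsGT_zero (𝕜 := ℝ)).comp <|
      tendsto_nhdsWithin_iff.2 ⟨hlim', Eventually.of_forall fun k => div_pos (hup k) (hvp k)⟩)
  · refine summable_of_sum_range_le (c := u N / v N) (fun k =>
      (one_div_pos.2 (mul_pos (mul_pos (hrp k) (hvp k)) (hvp (k + 1)))).le) fun n => ?_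
    have e : ∑ k ∈ Finset.range n, 1 / (r (N + k) * v (N + k) * v (N + k + 1))
        = u N / v N - u (N + n) / v (N + n) := by
      refine (Finset.sum_congr rfl fun k _ => ?_).trans
        (Finset.sum_range_sub' (fun k => u (N + k) / v (N + k)) n)
      exact (div_sub_div_of_casoratian (hrp k).ne' (hvp k).ne' (hvp (k + 1)).ne'
        (hc _ (by omega))).symm
    rw [e]
    linarith [div_pos (hup n) (hvp n)]

/-- The structure of principal pairs of `Δ (r_n Δ z_n) = 0`. -/
theorem IsPrincipalPair.exists_slopes {N : ℕ} {r u v : ℕ → ℝ} (hr : ∀ n, N ≤ n → 0 < r n)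
    (h : IsPrincipalPair N r (fun _ => 0) u v) :
    ∃ κ μ : ℝ, 0 ≤ κ ∧ (∀ n, N ≤ n → u n - u (n + 1) = κ * (r n)⁻¹) ∧
      (∀ n, N ≤ n → v (n + 1) - v n = μ * (r n)⁻¹) := by
  have hconst : ∀ y, IsDiffSolution N r (fun _ => 0) y → ∀ n, N ≤ n →
      r n * (y (n + 1) - y n) = r N * (y (N + 1) - y N) := by
    intro y hy n hn
    induction n, hn using Nat.le_induction with
    | base => rfl
    | succ n hn ih =>
      have := isDiffSolution_iff.1 hy n hn
      rw [show n + 1 + 1 = n + 2 from rfl]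
      linear_combination this + ih
  have hu := hconst u h.left
  have hv := hconst v h.right
  set κ := -(r N * (u (N + 1) - u N)) with hκ
  set μ := r N * (v (N + 1) - v N) with hμ
  -- Inserting the constant values of `r Δu` and `r Δv` into the Casoratian turns it into a linear
  -- relation; dividing it by `v` and letting `u/v → 0` yields `κ ≥ 0`.
  have hrel : ∀ n, N ≤ n → μ * u n + κ * v n = 1 := fun n hn => by
    linear_combination h.casoratian n hn - u n * hv n hn + v n * hu n hn
  refine ⟨κ, μ, ?_, fun n hn => ?_, fun n hn => ?_⟩
  · obtain ⟨n₀, hn₀, hpos, -, -⟩ := h.eventually_pos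
    have h1 : Tendsto (fun n => -(μ * (u n / v n))) atTop (𝓝 0) := by
      simpa using (h.tendsto_div.const_mul μ).neg
    refine le_of_tendsto h1 ?_
    filter_upwards [eventually_ge_atTop n₀] with n hn
    have hvn := (hpos n hn).2
    have h2 := hrel n (hn₀.trans hn)
    have h3 : -(μ * (u n / v n)) = κ - 1 / v n := by
      field_simp
      linear_combination -h2
    rw [h3]
    linarith [one_div_pos.2 hvn]
  · have := (hr n hn).ne'
    field_simp
    linear_combination -hu n hn
  · have := (hr n hn).ne'
    field_simp
    linear_combination hv n hn

/-! ### Power weights: existence, growth and sufficiency -/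

/-- Splitting off the summable factor `k^{-1-ε}` costs only `ε` in the exponent and treats the
logarithmic case `α = 1` like the others. The strict inequality `α + β > 2` leaves room for the
loss. -/
theorem sum_Ico_rpow_neg_le {α ε B : ℝ} (hε : 0 < ε) {a b : ℕ} (ha : 1 ≤ a) (hB0 : 0 ≤ B)
    (hB : ∀ k ∈ Finset.Ico a b, (k : ℝ) ^ (1 - α + ε) ≤ B) :
    ∑ k ∈ Finset.Ico a b, (k : ℝ) ^ (-α) ≤ (∑' k : ℕ, (k : ℝ) ^ (-1 - ε)) * B := by
  have hs : Summable fun k : ℕ => (k : ℝ) ^ (-1 - ε) := Real.summable_nat_rpow.2 (by linarith)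
  calc ∑ k ∈ Finset.Ico a b, (k : ℝ) ^ (-α)
      ≤ ∑ k ∈ Finset.Ico a b, (k : ℝ) ^ (-1 - ε) * B := Finset.sum_le_sum fun k hk => by
        have hk0 : (0 : ℝ) < k := by
          have := (Finset.mem_Ico.1 hk).1
          exact_mod_cast (by omega : 0 < k)
        calc (k : ℝ) ^ (-α) = (k : ℝ) ^ (-1 - ε) * (k : ℝ) ^ (1 - α + ε) := by
              rw [← Real.rpow_add hk0]; ring_nf
          _ ≤ _ := mul_le_mul_of_nonneg_left (hB k hk) (Real.rpow_nonneg hk0.le _)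
    _ = (∑ k ∈ Finset.Ico a b, (k : ℝ) ^ (-1 - ε)) * B := (Finset.sum_mul _ _ _).symm
    _ ≤ _ := mul_le_mul_of_nonneg_right
        (hs.sum_le_tsum _ fun k _ => Real.rpow_nonneg (Nat.cast_nonneg k) _) hB0

theorem natCast_rpow_pos (α : ℝ) : ∀ n : ℕ, 1 ≤ n → 0 < (n : ℝ) ^ α := fun n hn =>
  Real.rpow_pos_of_pos (by exact_mod_cast hn) α

/-- Principal pairs of `Δ (n^α Δ z_n) = 0` exist. -/
theorem exists_isPrincipalPair_rpow (α : ℝ) :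
    ∃ u v : ℕ → ℝ, IsPrincipalPair 1 (fun n => (n : ℝ) ^ α) (fun _ => 0) u v := by
  set S : ℕ → ℝ := fun n => ∑ k ∈ Finset.range n, ((k + 1 : ℕ) : ℝ) ^ (-α) with hS
  have hrp := natCast_rpow_pos α
  have hSd : ∀ n : ℕ, 1 ≤ n → (n : ℝ) ^ α * (S n - S (n - 1)) = 1 := fun n hn => by
    obtain ⟨k, rfl⟩ := Nat.exists_eq_add_of_le' hn
    simp only [hS, Nat.add_sub_cancel, Finset.sum_range_succ, add_sub_cancel_left]
    rw [Real.rpow_neg (Nat.cast_nonneg _), mul_inv_cancel₀ (hrp (k + 1) hn).ne']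
  have hSn : ∀ n, 0 ≤ S n := fun n =>
    Finset.sum_nonneg fun k _ => Real.rpow_nonneg (Nat.cast_nonneg _) _
  have hSsol : ∀ a b : ℝ, IsDiffSolution 1 (fun n => (n : ℝ) ^ α) (fun _ => 0)
      (fun n => a + b * S (n - 1)) := fun a b => isDiffSolution_iff.2 fun n hn => by
    have h1 := hSd n hn
    have h2 := hSd (n + 1) (by omega)
    rw [show n + 2 - 1 = n + 1 by omega]
    simp only [Nat.add_sub_cancel] at h2 ⊢
    linear_combination b * h2 - b * h1
  -- If `∑ k^{-α}` converges, its tails are principal and `1` is non-principal; otherwise `1` is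
  -- principal and one plus the partial sums is non-principal.
  by_cases hα : Summable fun k : ℕ => ((k + 1 : ℕ) : ℝ) ^ (-α)
  · set T := ∑' k : ℕ, ((k + 1 : ℕ) : ℝ) ^ (-α) with hT
    refine ⟨fun n => T + (-1) * S (n - 1), fun n => 1 + 0 * S (n - 1),
      isPrincipalPair_of_pos hrp (hSsol _ _) (hSsol _ _) (fun n hn => ?_) ?_ fun n hn => ?_⟩
    · simp only [Nat.add_sub_cancel]
      linear_combination hSd n hn
    · have h1 : Tendsto (fun n => T + (-1) * S n) atTop (𝓝 0) := by
        have h2 := (hα.hasSum.tendsto_sum_nat.const_mul (-1)).const_add T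
        rwa [← hT, neg_one_mul, add_neg_cancel] at h2
      simpa [Function.comp_def] using h1.comp (tendsto_sub_atTop_nat 1)
    · refine ⟨?_, by simp⟩
      have h1 := hα.sum_le_tsum (Finset.range n) fun k _ =>
        Real.rpow_nonneg (Nat.cast_nonneg _) _
      have h2 := hSd n hn
      have h3 := hrp n hn
      have h4 : 0 < S n - S (n - 1) := by
        by_contra h5
        nlinarith
      change S n ≤ T at h1
      linarith
  · refine ⟨fun n => 1 + 0 * S (n - 1), fun n => 1 + 1 * S (n - 1),
      isPrincipalPair_of_pos hrp (hSsol _ _) (hSsol _ _) (fun n hn => ?_) ?_ fun n hn => ?_⟩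
    · simp only [Nat.add_sub_cancel]
      linear_combination hSd n hn
    · have h1 : Tendsto S atTop atTop :=
        (not_summable_iff_tendsto_nat_atTop_of_nonneg fun k =>
          Real.rpow_nonneg (Nat.cast_nonneg _) _).1 hα
      have h2 := tendsto_inv_atTop_zero.comp
        ((tendsto_atTop_add_const_left _ 1 h1).comp (tendsto_sub_atTop_nat 1))
      simpa [Function.comp_def] using h2
    · have := hSn (n - 1)
      constructor <;> linarith

/-- Growth of a sequence with increments `μ n^{-α}`. -/
theorem exists_abs_le_rpow {α ε μ : ℝ} (hε : 0 < ε) (hγ : 0 ≤ 1 - α + ε) {v : ℕ → ℝ}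
    (hv : ∀ n, 1 ≤ n → v (n + 1) - v n = μ * ((n : ℝ) ^ α)⁻¹) :
    ∃ C, 0 ≤ C ∧ ∀ n, 1 ≤ n → |v n| ≤ C * (n : ℝ) ^ (1 - α + ε) := by
  have hZ : 0 ≤ ∑' k : ℕ, (k : ℝ) ^ (-1 - ε) :=
    tsum_nonneg fun k => Real.rpow_nonneg (Nat.cast_nonneg k) _
  refine ⟨|v 1| + |μ| * ∑' k : ℕ, (k : ℝ) ^ (-1 - ε), by positivity, fun n hn => ?_⟩
  have h1 : v n = v 1 + μ * ∑ k ∈ Finset.Ico 1 n, (k : ℝ) ^ (-α) := by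
    rw [Finset.mul_sum, ← sub_eq_iff_eq_add', ← Finset.sum_Ico_sub v hn]
    refine Finset.sum_congr rfl fun k hk => ?_
    rw [hv k (Finset.mem_Ico.1 hk).1, Real.rpow_neg (Nat.cast_nonneg k)]
  have h2 := sum_Ico_rpow_neg_le (α := α) hε (a := 1) (b := n) le_rfl
    (Real.rpow_nonneg (Nat.cast_nonneg n) (1 - α + ε)) fun k hk =>
      Real.rpow_le_rpow (Nat.cast_nonneg k) (by exact_mod_cast (Finset.mem_Ico.1 hk).2.le) hγ
  have h3 : 1 ≤ (n : ℝ) ^ (1 - α + ε) := Real.one_le_rpow (by exact_mod_cast hn) hγ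
  have h4 : 0 ≤ ∑ k ∈ Finset.Ico 1 n, (k : ℝ) ^ (-α) :=
    Finset.sum_nonneg fun k _ => Real.rpow_nonneg (Nat.cast_nonneg k) _
  rw [h1]
  refine (abs_add_le _ _).trans ?_
  rw [abs_mul, abs_of_nonneg h4, add_mul, mul_assoc]
  exact add_le_add (le_mul_of_one_le_right (abs_nonneg _) h3)
    (mul_le_mul_of_nonneg_left h2 (abs_nonneg _))

/-- Decay of a null sequence with increments `-κ n^{-α}`. -/
theorem le_rpow_of_tendsto_zero {α ε κ : ℝ} (hε : 0 < ε) (hγ : 1 - α + ε ≤ 0) (hκ : 0 ≤ κ)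
    {u : ℕ → ℝ} (hu : ∀ n, 1 ≤ n → u n - u (n + 1) = κ * ((n : ℝ) ^ α)⁻¹)
    (hlim : Tendsto u atTop (𝓝 0)) {n : ℕ} (hn : 1 ≤ n) :
    u n ≤ κ * (∑' k : ℕ, (k : ℝ) ^ (-1 - ε)) * (n : ℝ) ^ (1 - α + ε) := by
  have h1 : Tendsto (fun m => u n - u m) atTop (𝓝 (u n)) := by
    simpa using hlim.const_sub (u n)
  refine le_of_tendsto h1 ?_
  filter_upwards [eventually_ge_atTop n] with m hm
  have h2 : u n - u m = κ * ∑ k ∈ Finset.Ico n m, (k : ℝ) ^ (-α) := by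
    have := Finset.sum_Ico_sub u hm
    rw [Finset.mul_sum, ← neg_sub, ← this, ← Finset.sum_neg_distrib]
    refine Finset.sum_congr rfl fun k hk => ?_
    rw [neg_sub, hu k (hn.trans (Finset.mem_Ico.1 hk).1), Real.rpow_neg (Nat.cast_nonneg k)]
  rw [h2, mul_assoc]
  refine mul_le_mul_of_nonneg_left (sum_Ico_rpow_neg_le hε hn
    (Real.rpow_nonneg (Nat.cast_nonneg n) (1 - α + ε)) fun k hk => ?_) hκ
  exact Real.rpow_le_rpow_of_nonpos (by exact_mod_cast hn)
    (by exact_mod_cast (Finset.mem_Ico.1 hk).1) hγ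

theorem antitone_of_sub_eq {α κ : ℝ} (hκ : 0 ≤ κ) {u : ℕ → ℝ}
    (hu : ∀ n, 1 ≤ n → u n - u (n + 1) = κ * ((n : ℝ) ^ α)⁻¹) {m n : ℕ} (hm : 1 ≤ m)
    (hmn : m ≤ n) : u n ≤ u m := by
  induction n, hmn using Nat.le_induction with
  | base => exact le_rfl
  | succ n hmn ih =>
    have h1 := hu n (hm.trans hmn)
    have h2 := mul_nonneg hκ (inv_nonneg.2 (natCast_rpow_pos α n (hm.trans hmn)).le)
    linarith

/-- For `α ≤ 1`, `u` is bounded and `v` is `O(n^{1-α+ε})`. For `α > 1`, `v` is bounded, which forces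
`u = (u/v) v → 0`, and `u` is then `O(n^{1-α+ε})` as a tail sum. -/
theorem summable_rpow_mul_of_isPrincipalPair {α β : ℝ} (hαβ : 2 < α + β) {u v : ℕ → ℝ}
    (h : IsPrincipalPair 1 (fun n => (n : ℝ) ^ α) (fun _ => 0) u v) :
    Summable fun n : ℕ => (n : ℝ) ^ (-β) * u n * v n := by
  obtain ⟨κ, μ, hκ, hu, hv⟩ := h.exists_slopes (natCast_rpow_pos α)
  obtain ⟨n₀, hn₀, hpos, -, -⟩ := h.eventually_pos
  have key : ∀ C ε : ℝ, ε < α + β - 2 →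
      (∀ n : ℕ, n₀ ≤ n → u n * v n ≤ C * (n : ℝ) ^ (1 - α + ε)) →
      Summable fun n : ℕ => (n : ℝ) ^ (-β) * u n * v n := by
    intro C ε hε hb
    refine Summable.of_norm_bounded_eventually_nat (g := fun n => C * (n : ℝ) ^ (1 - α + ε - β))
      ((Real.summable_nat_rpow.2 (by linarith)).mul_left C) ?_
    filter_upwards [eventually_ge_atTop n₀] with n hn
    have hn1 : (0 : ℝ) < n := by exact_mod_cast (hn₀.trans hn)
    have hp := mul_pos (hpos n hn).1 (hpos n hn).2
    have hs := Real.rpow_pos_of_pos hn1 (-β)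
    rw [mul_assoc, Real.norm_of_nonneg (mul_pos hs hp).le, sub_eq_add_neg (1 - α + ε) β,
      Real.rpow_add hn1, ← mul_assoc C, mul_comm ((n : ℝ) ^ (-β)) (u n * v n)]
    exact mul_le_mul_of_nonneg_right (hb n hn) hs.le
  rcases le_or_gt α 1 with h1 | h1
  · obtain ⟨C, hC, hvb⟩ := exists_abs_le_rpow (α := α) (ε := (α + β - 2) / 2)
      (by linarith) (by linarith) hv
    refine key (u 1 * C) ((α + β - 2) / 2) (by linarith) fun n hn => ?_
    have hn1 := hn₀.trans hn
    rw [mul_assoc]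
    have h2 := antitone_of_sub_eq hκ hu le_rfl hn1
    exact mul_le_mul h2 ((le_abs_self _).trans (hvb n hn1)) (hpos n hn).2.le
      ((hpos n hn).1.le.trans h2)
  -- `ε = α - 1` makes the exponent `0`, so the growth bound becomes boundedness.
  · obtain ⟨C, hC, hvb⟩ := exists_abs_le_rpow (α := α) (ε := α - 1)
      (by linarith) (by linarith) hv
    have hvb' : ∀ n, 1 ≤ n → |v n| ≤ C := fun n hn => by
      simpa using hvb n hn
    have hu0 : Tendsto u atTop (𝓝 0) := by
      have h2 := h.tendsto_div.norm.mul_const C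
      rw [norm_zero, zero_mul] at h2
      refine squeeze_zero_norm' ?_ h2
      filter_upwards [eventually_ge_atTop n₀] with n hn
      have hvn := (hpos n hn).2
      calc ‖u n‖ = ‖u n / v n‖ * |v n| := by
            rw [norm_div, Real.norm_eq_abs (v n), div_mul_cancel₀ _ (abs_pos.2 hvn.ne').ne']
        _ ≤ _ := mul_le_mul_of_nonneg_left (hvb' n (hn₀.trans hn)) (norm_nonneg _)
    set ε := min ((α + β - 2) / 2) (α - 1) with hε
    have hε0 : 0 < ε := lt_min (by linarith) (by linarith)
    have hε1 : ε ≤ (α + β - 2) / 2 := min_le_left _ _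
    have hε2 : ε ≤ α - 1 := min_le_right _ _
    refine key (κ * (∑' k : ℕ, (k : ℝ) ^ (-1 - ε)) * C) ε (by linarith) fun n hn => ?_
    have hn1 := hn₀.trans hn
    have h2 := le_rpow_of_tendsto_zero hε0 (by linarith) hκ hu hu0 hn1
    rw [mul_right_comm]
    exact mul_le_mul h2 ((le_abs_self _).trans (hvb' n hn1)) (hpos n hn).2.le
      ((hpos n hn).1.le.trans h2)

/-! ### Necessity: dyadic blocks -/

/-- Two steps of `u` from index `2k` drop it by at least `κ (2k)^{-α}`, which is `2^{-α}` times its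
drop at `k`. Hence `u (2k) - 2^{-α} u k` decreases, to the limit `(1 - 2^{-α}) L ≥ 0`. -/
theorem rpow_neg_mul_le_two_mul {α κ : ℝ} (hα : 0 ≤ α) (hκ : 0 ≤ κ) {u : ℕ → ℝ}
    (hu : ∀ n, 1 ≤ n → u n - u (n + 1) = κ * ((n : ℝ) ^ α)⁻¹)
    (hpos : ∀ n, 1 ≤ n → 0 < u n) {n : ℕ} (hn : 1 ≤ n) :
    (2 : ℝ) ^ (-α) * u n ≤ u (2 * n) := by
  have hanti : Antitone fun k => u (k + 1) := antitone_nat_of_succ_le fun k =>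
    antitone_of_sub_eq hκ hu (by omega) (by omega)
  obtain ⟨L, hL⟩ : ∃ L, Tendsto u atTop (𝓝 L) :=
    ⟨_, (tendsto_add_atTop_iff_nat 1).1 (tendsto_atTop_ciInf hanti
      ⟨0, by rintro _ ⟨k, rfl⟩; exact (hpos _ (by omega)).le⟩)⟩
  have hL0 : 0 ≤ L := ge_of_tendsto hL (by
    filter_upwards [eventually_ge_atTop 1] with k hk using (hpos k hk).le)
  have hF : Antitone fun k => u (2 * (k + n)) - (2 : ℝ) ^ (-α) * u (k + n) :=
    antitone_nat_of_succ_le fun k => by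
      have h1 := hu (k + n) (by omega)
      have h2 := hu (2 * (k + n)) (by omega)
      have h3 := hu (2 * (k + n) + 1) (by omega)
      have h4 := mul_nonneg hκ (inv_nonneg.2 (natCast_rpow_pos α (2 * (k + n) + 1) (by omega)).le)
      have h5 : (((2 * (k + n) : ℕ) : ℝ) ^ α)⁻¹ = (2 : ℝ) ^ (-α) * (((k + n : ℕ) : ℝ) ^ α)⁻¹ := by
        rw [Nat.cast_mul, Real.mul_rpow (by norm_num) (Nat.cast_nonneg _), mul_inv,
          Real.rpow_neg (by norm_num)]
        norm_num
      rw [h5] at h2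
      rw [show k + 1 + n = k + n + 1 by omega,
        show 2 * (k + n + 1) = 2 * (k + n) + 1 + 1 by omega]
      linear_combination h4 - h2 - h3 + (2 : ℝ) ^ (-α) * h1
  have hFlim : Tendsto (fun k => u (2 * (k + n)) - (2 : ℝ) ^ (-α) * u (k + n)) atTop
      (𝓝 (L - (2 : ℝ) ^ (-α) * L)) := by
    refine Tendsto.sub (hL.comp ?_) ((tendsto_shift n hL).const_mul _)
    exact tendsto_atTop_mono (fun k => (by omega : k ≤ 2 * (k + n))) tendsto_id
  have h1 : (2 : ℝ) ^ (-α) ≤ 1 := Real.rpow_le_one_of_one_le_of_nonpos (by norm_num) (by linarith)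
  have h2 := hF.le_of_tendsto hFlim 0
  simp only [zero_add] at h2
  nlinarith

theorem two_rpow_mul_rpow_neg_le {β : ℝ} {n k : ℕ} (hn : 1 ≤ n) (h1 : n ≤ k) (h2 : k ≤ 2 * n) :
    (2 : ℝ) ^ (-|β|) * (n : ℝ) ^ (-β) ≤ (k : ℝ) ^ (-β) := by
  have hn0 : (0 : ℝ) < n := by exact_mod_cast hn
  have h1' : (n : ℝ) ≤ k := by exact_mod_cast h1
  have h2' : (k : ℝ) ≤ 2 * n := by exact_mod_cast h2
  rcases le_total 0 β with hβ | hβ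
  · rw [abs_of_nonneg hβ, ← Real.mul_rpow (by norm_num) hn0.le]
    exact Real.rpow_le_rpow_of_nonpos (hn0.trans_le h1') h2' (by linarith)
  · have h3 : (2 : ℝ) ^ (-|β|) ≤ 1 :=
      Real.rpow_le_one_of_one_le_of_nonpos (by norm_num) (by linarith [abs_nonneg β])
    calc (2 : ℝ) ^ (-|β|) * (n : ℝ) ^ (-β) ≤ 1 * (n : ℝ) ^ (-β) :=
          mul_le_mul_of_nonneg_right h3 (Real.rpow_nonneg hn0.le _)
      _ ≤ _ := by
          rw [one_mul]
          exact Real.rpow_le_rpow hn0.le h1' (by linarith)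

theorem two_lt_add_of_hartmanWintnerSolvable {α β : ℝ} (hα : 0 ≤ α) {u v : ℕ → ℝ}
    (h : IsPrincipalPair 1 (fun n => (n : ℝ) ^ α) (fun _ => 0) u v)
    (hs : HartmanWintnerSolvable 1 (fun n => (n : ℝ) ^ α) (fun _ => 0)
      (fun n => (((n : ℝ) ^ (-β) : ℝ) : ℂ)) u v) : 2 < α + β := by
  have hrp := natCast_rpow_pos α
  obtain ⟨x, hx, hxu, hX⟩ := hs.exists_real (σ := fun n : ℕ => (n : ℝ) ^ (-β)) hrp h
  obtain ⟨κ, -, hκ, hu, -⟩ := h.exists_slopes hrp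
  obtain ⟨n₀, hn₀, hpos, -, -⟩ := h.eventually_pos
  have hanti : ∀ m n, 1 ≤ m → m ≤ n → u n ≤ u m := fun m n hm hmn =>
    antitone_of_sub_eq hκ hu hm hmn
  -- Monotonicity carries eventual positivity of `u` back to index `1`.
  have hup : ∀ n, 1 ≤ n → 0 < u n := fun n hn =>
    (hpos (max n n₀) (le_max_right _ _)).1.trans_le (hanti n _ hn (le_max_left _ _))
  have hvp : ∀ n, n₀ ≤ n → 0 < v n := fun n hn => (hpos n hn).2
  set c : ℝ := (2 : ℝ) ^ (-α) with hc
  have hc0 : 0 < c := Real.rpow_pos_of_pos two_pos _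
  set s : ℝ := (2 : ℝ) ^ (-|β|) with hs'
  have hs0 : 0 < s := Real.rpow_pos_of_pos two_pos _
  have hdouble : ∀ n, 1 ≤ n → c * u n ≤ u (2 * n) := fun n hn =>
    rpow_neg_mul_le_two_mul hα hκ hu hup hn
  set X : ℕ → ℝ := fun n => (n : ℝ) ^ α * (x (n + 1) * u n - u (n + 1) * x n) with hXdef
  have hXd : ∀ n, 1 ≤ n → X (n + 1) - X n
      = ((n + 1 : ℕ) : ℝ) ^ (-β) * (x (n + 1) * u (n + 1)) := fun n hn => by
    have := h.left.casoratian_succ_sub hx hn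
    simpa [hXdef] using this
  have hVd : ∀ n, n₀ ≤ n → v (n + 1) / u (n + 1) - v n / u n
      = 1 / ((n : ℝ) ^ α * u n * u (n + 1)) := fun n hn => by
    have h1 := (hup n (hn₀.trans hn)).ne'
    have h2 := (hup (n + 1) (by omega)).ne'
    have h3 := (hrp n (hn₀.trans hn)).ne'
    have h4 := h.casoratian n (hn₀.trans hn)
    field_simp
    linear_combination h4
  have hVmono : ∀ m n, n₀ ≤ m → m ≤ n → v m / u m ≤ v n / u n := by
    intro m n hm hmn
    induction n, hmn using Nat.le_induction with
    | base => exact le_rfl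
    | succ n hmn ih =>
      have h1 := hVd n (hm.trans hmn)
      have h2 := one_div_pos.2 (mul_pos (mul_pos (hrp n (by omega)) (hup n (by omega)))
        (hup (n + 1) (by omega)))
      linarith
  have htwo : Tendsto (fun n : ℕ => 2 * n) atTop atTop :=
    tendsto_atTop_mono (fun k => (by omega : k ≤ 2 * k)) tendsto_id
  have hT : Tendsto (fun n => (X (2 * n) - X n) * (v n / u n)) atTop (𝓝 0) := by
    -- As `v/u` increases, `v_n/u_n` may be replaced by `v_{2n}/u_{2n}`, and the limit `hX` applies
    -- along even indices.
    have h1 : Tendsto (fun n => X (2 * n) * (v n / u n)) atTop (𝓝 0) := by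
      have h2 : Tendsto (fun n => ‖X (2 * n) * (v (2 * n) / u (2 * n))‖) atTop (𝓝 0) := by
        have h3 := (hX.comp htwo).norm
        rwa [norm_zero] at h3
      refine squeeze_zero_norm' ?_ h2
      filter_upwards [eventually_ge_atTop n₀] with n hn
      have h3 := div_pos (hvp n hn) (hup n (hn₀.trans hn))
      have h4 := hVmono n (2 * n) hn (by omega)
      rw [norm_mul (X (2 * n)), norm_mul (X (2 * n)), Real.norm_of_nonneg h3.le,
        Real.norm_of_nonneg (h3.le.trans h4)]
      exact mul_le_mul_of_nonneg_left h4 (norm_nonneg _)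
    have h2 := h1.sub hX
    rw [sub_zero] at h2
    exact h2.congr fun n => (sub_mul _ _ _).symm
  obtain ⟨K, hK⟩ := eventually_atTop.1 (hxu.eventually_const_le (by norm_num : (1 / 2 : ℝ) < 1))
  -- The increment of `X` over a dyadic block.
  have hXlow : ∀ n, 1 ≤ n → K ≤ n →
      n * (s * (n : ℝ) ^ (-β) * ((c * u n) ^ 2 / 2)) ≤ X (2 * n) - X n := by
    intro n hn hKn
    rw [← Finset.sum_Ico_sub X (by omega : n ≤ 2 * n)]
    have hcard : (Finset.Ico n (2 * n)).card = n := by rw [Nat.card_Ico]; omega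
    have h1 := Finset.card_nsmul_le_sum (Finset.Ico n (2 * n)) (fun k => X (k + 1) - X k)
      (s * (n : ℝ) ^ (-β) * ((c * u n) ^ 2 / 2)) fun k hk => by
        obtain ⟨hk1, hk2⟩ := Finset.mem_Ico.1 hk
        have huk := hup (k + 1) (by omega)
        have h2 : c * u n ≤ u (k + 1) :=
          (hdouble n hn).trans (hanti (k + 1) (2 * n) (by omega) (by omega))
        have h3 : u (k + 1) / 2 ≤ x (k + 1) := by
          have := (le_div_iff₀ huk).1 (hK (k + 1) (by omega))
          linarith
        have h4 := mul_pos hc0 (hup n hn)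
        rw [hXd k (hn.trans hk1)]
        refine mul_le_mul (two_rpow_mul_rpow_neg_le hn (by omega) (by omega)) ?_ (by positivity)
          (Real.rpow_nonneg (Nat.cast_nonneg _) _)
        calc (c * u n) ^ 2 / 2 ≤ u (k + 1) ^ 2 / 2 := by gcongr
          _ = u (k + 1) / 2 * u (k + 1) := by ring
          _ ≤ _ := mul_le_mul_of_nonneg_right h3 huk.le
    rwa [hcard, nsmul_eq_mul] at h1
  -- The growth of `u v` along even indices.
  have huv : ∀ m, n₀ ≤ m → c ^ 2 * (m * (((2 * m : ℕ) : ℝ) ^ α)⁻¹) ≤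
      u (2 * m) ^ 2 * (v (2 * m) / u (2 * m)) := by
    intro m hm
    have hm1 := hn₀.trans hm
    have hum := hup m hm1
    have hr2 := hrp (2 * m) (by omega)
    -- Each increment of `v/u` in the block is at least `1/((2m)^α u_m²)`; here `α ≥ 0` and the
    -- decrease of `u` are used.
    have h1 := Finset.card_nsmul_le_sum (Finset.Ico m (2 * m))
      (fun k => v (k + 1) / u (k + 1) - v k / u k)
      (1 / (((2 * m : ℕ) : ℝ) ^ α * u m * u m)) fun k hk => by
        obtain ⟨hk1, hk2⟩ := Finset.mem_Ico.1 hk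
        have e1 := hrp k (hm1.trans hk1)
        have e2 := hup k (hm1.trans hk1)
        have e3 := hup (k + 1) (by omega)
        have e4 := hanti m k hm1 hk1
        have e5 := hanti m (k + 1) hm1 (by omega)
        have e6 : (k : ℝ) ^ α ≤ ((2 * m : ℕ) : ℝ) ^ α :=
          Real.rpow_le_rpow (Nat.cast_nonneg _) (by exact_mod_cast hk2.le) hα
        rw [hVd k (hm.trans hk1)]
        gcongr
    rw [Finset.sum_Ico_sub (fun k => v k / u k) (by omega : m ≤ 2 * m),
      show (Finset.Ico m (2 * m)).card = m by rw [Nat.card_Ico]; omega, nsmul_eq_mul] at h1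
    have h2 := div_pos (hvp m hm) hum
    have h3 : (m : ℝ) * (1 / (((2 * m : ℕ) : ℝ) ^ α * u m * u m)) ≤ v (2 * m) / u (2 * m) := by
      linarith
    have h4 := mul_pos hc0 hum
    calc c ^ 2 * (m * (((2 * m : ℕ) : ℝ) ^ α)⁻¹)
        = (c * u m) ^ 2 * (m * (1 / (((2 * m : ℕ) : ℝ) ^ α * u m * u m))) := by
          field_simp
      _ ≤ u (2 * m) ^ 2 * (v (2 * m) / u (2 * m)) := by
          have := hdouble m hm1
          gcongr
  by_contra hcon
  -- At `n = 2m` the block bound contributes `s c²/2` and the bound on `u v` contributes `c²/2`; the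
  -- remaining factor `(2m)^{2-α-β}` is at least `1` if `α + β ≤ 2`.
  have hδ : 0 < s * c ^ 4 / 4 := by positivity
  obtain ⟨K', hK'⟩ := eventually_atTop.1 ((hT.comp htwo).eventually_lt_const hδ)
  set m := max n₀ (max K K') with hm
  have hm₀ : n₀ ≤ m := le_max_left _ _
  have hmK : K ≤ m := (le_max_left _ _).trans (le_max_right _ _)
  have hmK' : K' ≤ m := (le_max_right _ _).trans (le_max_right _ _)
  refine absurd (hK' m hmK') (not_lt.2 ?_)
  have hV : 0 < v (2 * m) / u (2 * m) := div_pos (hvp _ (by omega)) (hup _ (by omega))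
  have h2m : (0 : ℝ) < ((2 * m : ℕ) : ℝ) := by exact_mod_cast (by omega : 0 < 2 * m)
  have h1 := mul_le_mul_of_nonneg_right (hXlow (2 * m) (by omega) (by omega)) hV.le
  have h2 := huv m hm₀
  refine le_trans ?_ h1
  have hcast : (m : ℝ) = ((2 * m : ℕ) : ℝ) / 2 := by push_cast; ring
  rw [hcast, ← Real.rpow_neg h2m.le] at h2
  have h3 : 0 ≤ ((2 * m : ℕ) : ℝ) * (s * ((2 * m : ℕ) : ℝ) ^ (-β) * (c ^ 2 / 2)) := by
    have := Real.rpow_pos_of_pos h2m (-β)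
    positivity
  have h4 := mul_le_mul_of_nonneg_left h2 h3
  have h5 : (1 : ℝ) ≤ ((2 * m : ℕ) : ℝ) ^ (1 + 1 + -β + -α) :=
    Real.one_le_rpow (by exact_mod_cast (by omega : 1 ≤ 2 * m)) (by linarith)
  rw [Real.rpow_add h2m, Real.rpow_add h2m, Real.rpow_add h2m, Real.rpow_one] at h5
  have h6 := mul_le_mul_of_nonneg_left h5 hδ.le
  refine le_trans (by linarith) (h6.trans (le_trans (le_of_eq ?_) (h4.trans (le_of_eq ?_))))
  · ring
  · ring

/-- The equation `Δ (n^α Δ y_n) = (n+1)^{-β} y_{n+1}`, `n ≥ 1`, as a perturbation of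
`Δ (n^α Δ z_n) = 0`, `n ≥ 1`: principal pairs `u, v` of the latter exist, and for each of them the
Hartman–Wintner problem is solvable if and only if `α + β > 2`. -/
theorem mainTheorem7 (α β : ℝ) (hα : 0 ≤ α) :
    (∃ u v : ℕ → ℝ, IsPrincipalPair 1 (fun n => (n : ℝ) ^ α) (fun _ => 0) u v) ∧
    ∀ u v : ℕ → ℝ, IsPrincipalPair 1 (fun n => (n : ℝ) ^ α) (fun _ => 0) u v →
      (HartmanWintnerSolvable 1 (fun n => (n : ℝ) ^ α) (fun _ => 0)
          (fun n => (((n : ℝ) ^ (-β) : ℝ) : ℂ)) u v ↔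
        2 < α + β) := by
  refine ⟨exists_isPrincipalPair_rpow α, fun u v h =>
    ⟨two_lt_add_of_hartmanWintnerSolvable hα h, fun hαβ => ?_⟩⟩
  exact hartmanWintnerSolvable_of_summable (natCast_rpow_pos α)
    (fun n _ => Real.rpow_nonneg (Nat.cast_nonneg n) _) h
    (summable_rpow_mul_of_isPrincipalPair hαβ h)
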